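/- Let $p\in\mathbb R$ and $\delta>0$, and assume the following. (Errors) $\varepsilon_1,\varepsilon_2,\dots$ are independent and identically distributed real random variables with $E[|\varepsilon_1|^{p-1}\operatorname{sign}(\varepsilon_1)]=0$ and $E[|\varepsilon_1|^{(p-1)(2+\delta)}]<\infty$; if $p\le 1$, also $P(\varepsilon_1=0)=0$ (for $p<1$ this is already implied by the moment condition). (Design) $x_1,x_2,\dots$ are independent real random variables, independent of the sequence $(\varepsilon_i)$, with common probability density $f\ge 0$ that vanishes outside a bounded open interval $(a,b)$ and is differentiable on $(a,b)$ with bounded derivative there. (Kernel) $K_h(u)=h^{-1}K(u/h)$ for $h>0$, where $K=K_1:\mathbb R\to[0,\infty)$ is measurable, symmetric, zero outside $[-1,1]$, and $R(K)=\int K(u)^2\,du<\infty$. Write $\mu_2(K^2)=\int u^2K(u)^2\,du$. (Bandwidth) $h=h_n$ satisfies $h\to 0$, $nh\to\infty$ and $nh^5\to 0$ as $n\to\infty$. Fix $x\in(a,b)$ (so that $x\in(a+h,b-h)$ for all large $n$), and for $j=0,1$ let $$V_{jn}=\frac1{h^j}\sqrt{\frac hn}\sum_{i=1}^n (x_i-x)^j\,|\varepsilon_i|^{p-1}\operatorname{sign}(\varepsilon_i)\,K_h(x_i-x).$$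 Then, as $n\to\infty$, $$(V_{0n},V_{1n})\xrightarrow{\ \mathcal D\ }N\!\left((0,0),\ \begin{bmatrix}R(K)&0\\0&\mu_2(K^2)\end{bmatrix} f(x)\,E\big[|\varepsilon_1|^{2p-2}\big]\right).$$ -/

import Mathlib

open MeasureTheory ProbabilityTheory Filter Topology

noncomputable section

/-- The score transformation `e ↦ |e|^(p-1) sign e` of the `L_p` norm. -/
def lpScore (p e : ℝ) : ℝ := |e| ^ (p - 1) * Real.sign e

/-- The kernel `K_h(u) = K(u / h) / h` with scale parameter `h`, where `K = K_1`. -/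
def scaledKernel (K : ℝ → ℝ) (h u : ℝ) : ℝ := K (u / h) / h

/-- The roughness `R(K) = ∫ K(u)² du`. -/
def roughness (K : ℝ → ℝ) : ℝ := ∫ u, K u ^ 2

/-- The second moment `μ₂(g) = ∫ u² g(u) du`. -/
def secondMoment (g : ℝ → ℝ) : ℝ := ∫ u, u ^ 2 * g u

/-- `h^{-j} √(h/n) ∑_{i<n} (x_i - x)^j |ε_i|^{p-1} sign(ε_i) K_h(x_i - x)`,
as a random variable, for the design points `X` and the errors `ε`. -/
def kernelSum {Ω : Type*} (p : ℝ) (K : ℝ → ℝ) (X ε : ℕ → Ω → ℝ) (x h : ℝ) (j n : ℕ) (ω : Ω) : ℝ :=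
  1 / h ^ j * √(h / n) *
    ∑ i ∈ Finset.range n,
      (X i ω - x) ^ j * lpScore p (ε i ω) * scaledKernel K h (X i ω - x)

end

/-! By Lévy's continuity theorem it suffices to follow characteristic functions. For fixed `t`, `t 0
* V₀ + t 1 * V₁` is a sum of `n` i.i.d. terms `ψ(ε_i) w((x_i - x)/h) / √(nh)`, where `ψ = lpScore p`
and `w u = (t 0 + t 1 * u) * K u` (`kernelSum_linear_combination`). The characteristic function is
thus an `n`-th power `φₙ ^ n`, and the limit of `n (φₙ - 1)` decides everything. As `ψ(ε)` is
centred and independent of the design, `φₙ - 1` is the mean of the second-order remainder of `exp (i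
r)`. Substituting `y = x + h u` yields a factor `h`, and `nh` cancels the square of the
normalisation; dominated convergence gives `-f(x) E[ψ²] ∫ w² / 2`
(`tendsto_nat_mul_integral_exp_sub_one`). Symmetry of `K` removes the cross term of `∫ w²`, so the
covariance is diagonal. -/

/-! ### Independence of pairs. -/

/-- Pairing two independent sequences of independent variables gives independent pairs. -/
lemma iIndepFun_prodMk_of_measurable {Ω ι α β : Type*} {mΩ : MeasurableSpace Ω}
    {mα : MeasurableSpace α} {mβ : MeasurableSpace β} {P : Measure Ω}
    {X : ι → Ω → α} {Y : ι → Ω → β} (mX : ∀ i, Measurable (X i)) (mY : ∀ i, Measurable (Y i))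
    (hX : iIndepFun X P) (hY : iIndepFun Y P)
    (hXY : IndepFun (fun ω i => X i ω) (fun ω i => Y i ω) P) :
    iIndepFun (fun i ω => (X i ω, Y i ω)) P := by
  have := hX.isProbabilityMeasure
  let R : Set (Set (α × β)) := Set.image2 (· ×ˢ ·) {s | MeasurableSet s} {t | MeasurableSet t}
  refine iIndepSets.iIndep (m := fun i => MeasurableSpace.comap (fun ω => (X i ω, Y i ω))
    inferInstance) (π := fun i => {t | ∃ s ∈ R, (fun ω => (X i ω, Y i ω)) ⁻¹' s = t})
    (fun i => ((mX i).prodMk (mY i)).comap_le) (fun i => isPiSystem_prod.comap _) (fun i => ?_) ?_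
  · rw [← generateFrom_prod, MeasurableSpace.comap_generateFrom]
    rfl
  rw [iIndepSets_iff]
  intro S T hT
  -- Indices outside `S` get empty sets, only to make the choice total.
  have key : ∀ i, ∃ A : Set α, ∃ B : Set β, MeasurableSet A ∧ MeasurableSet B ∧
      (i ∈ S → T i = X i ⁻¹' A ∩ Y i ⁻¹' B) := by
    intro i
    by_cases hi : i ∈ S
    · obtain ⟨_, ⟨A, hA, B, hB, rfl⟩, h⟩ := hT i hi
      exact ⟨A, B, hA, hB, fun _ => h ▸ by ext; simp⟩
    · exact ⟨∅, ∅, .empty, .empty, fun h => absurd h hi⟩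
  choose A B hA hB hAB using key
  -- Used for `J = S` to separate the two families, and for singletons to recombine each pair.
  have hcross (J : Finset ι) : P ((⋂ i ∈ J, X i ⁻¹' A i) ∩ ⋂ i ∈ J, Y i ⁻¹' B i) =
      P (⋂ i ∈ J, X i ⁻¹' A i) * P (⋂ i ∈ J, Y i ⁻¹' B i) := by
    have hm1 : MeasurableSet (⋂ i ∈ J, (fun z : ι → α => z i) ⁻¹' A i) :=
      J.measurableSet_biInter fun i _ => measurable_pi_apply i (hA i)
    have hm2 : MeasurableSet (⋂ i ∈ J, (fun z : ι → β => z i) ⁻¹' B i) :=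
      J.measurableSet_biInter fun i _ => measurable_pi_apply i (hB i)
    simpa [Set.preimage_iInter, Set.preimage_preimage] using
      hXY.measure_inter_preimage_eq_mul _ _ hm1 hm2
  have hS : ⋂ i ∈ S, T i = (⋂ i ∈ S, X i ⁻¹' A i) ∩ ⋂ i ∈ S, Y i ⁻¹' B i := by
    rw [Set.iInter₂_congr hAB]
    simp only [Set.iInter_inter_distrib]
  rw [hS, hcross, iIndepFun_iff_measure_inter_preimage_eq_mul.1 hX S fun i _ => hA i,
    iIndepFun_iff_measure_inter_preimage_eq_mul.1 hY S fun i _ => hB i, ← Finset.prod_mul_distrib]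
  refine Finset.prod_congr rfl fun i hi => ?_
  rw [hAB i hi]
  simpa using (hcross {i}).symm

lemma iIndepFun_prodMk_of_aemeasurable {Ω ι α β : Type*} [Countable ι] {mΩ : MeasurableSpace Ω}
    {mα : MeasurableSpace α} {mβ : MeasurableSpace β} {P : Measure Ω}
    {X : ι → Ω → α} {Y : ι → Ω → β} (mX : ∀ i, AEMeasurable (X i) P)
    (mY : ∀ i, AEMeasurable (Y i) P) (hX : iIndepFun X P) (hY : iIndepFun Y P)
    (hXY : IndepFun (fun ω i => X i ω) (fun ω i => Y i ω) P) :
    iIndepFun (fun i ω => (X i ω, Y i ω)) P := by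
  have eX : (fun ω i => X i ω) =ᵐ[P] fun ω i => (mX i).mk _ ω := by
    filter_upwards [ae_all_iff.2 fun i => (mX i).ae_eq_mk] with ω h using funext h
  have eY : (fun ω i => Y i ω) =ᵐ[P] fun ω i => (mY i).mk _ ω := by
    filter_upwards [ae_all_iff.2 fun i => (mY i).ae_eq_mk] with ω h using funext h
  refine (iIndepFun_prodMk_of_measurable (fun i => (mX i).measurable_mk)
    (fun i => (mY i).measurable_mk) (hX.congr fun i => (mX i).ae_eq_mk)
    (hY.congr fun i => (mY i).ae_eq_mk) (hXY.congr eX eY)).congr fun i => ?_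
  filter_upwards [(mX i).ae_eq_mk, (mY i).ae_eq_mk] with ω h1 h2
  rw [← h1, ← h2]

/-! ### Taylor remainder of the exponential. -/

/-- The remainder of `exp (i r)` after its linear Taylor polynomial. -/
noncomputable def expRemainder (r : ℝ) : ℂ := Complex.exp (r * Complex.I) - 1 - r * Complex.I

lemma continuous_expRemainder : Continuous expRemainder := by
  unfold expRemainder; fun_prop

/-- Being valid for every `r`, this gives a dominating function that needs second moments only. For
`|r| > 1` the triangle inequality `2 + |r|` is enough. -/
lemma norm_expRemainder_le (r : ℝ) : ‖expRemainder r‖ ≤ 3 * r ^ 2 := by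
  have hn : ‖(r : ℂ) * Complex.I‖ = |r| := by simp
  rcases le_or_gt |r| 1 with h | h
  · have := Complex.norm_exp_sub_one_sub_id_le (x := r * Complex.I) (by rwa [hn])
    rw [hn, sq_abs] at this
    exact this.trans (by nlinarith [sq_nonneg r])
  · have h1 := norm_sub_le (Complex.exp (r * Complex.I) - 1) (r * Complex.I)
    have h2 := norm_sub_le (Complex.exp (r * Complex.I)) 1
    rw [Complex.norm_exp_ofReal_mul_I, norm_one] at h2
    rw [hn] at h1
    unfold expRemainder
    nlinarith [sq_abs r]

/-- The cubic Taylor bound leaves an error of at most `|r| ^ 3 / s n`. Applied with `s n = √(n * h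
n)`. -/
lemma tendsto_sq_mul_expRemainder_div {s : ℕ → ℝ} (hs : Tendsto s atTop atTop) (r : ℝ) :
    Tendsto (fun n => ((s n ^ 2 : ℝ) : ℂ) * expRemainder (r / s n)) atTop
      (𝓝 ((-(r ^ 2 / 2) : ℝ) : ℂ)) := by
  rw [tendsto_iff_norm_sub_tendsto_zero]
  have hlim : Tendsto (fun n => |r| ^ 3 / s n) atTop (𝓝 0) := tendsto_const_nhds.div_atTop hs
  refine squeeze_zero' (.of_forall fun _ => norm_nonneg _) ?_ hlim
  filter_upwards [hs.eventually_ge_atTop (max |r| 1)] with n hn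
  have h0 : 0 < s n := lt_of_lt_of_le one_pos ((le_max_right _ _).trans hn)
  have hz : ‖((r / s n : ℝ) : ℂ) * Complex.I‖ = |r| / s n := by
    rw [norm_mul, Complex.norm_I, mul_one, Complex.norm_real, Real.norm_eq_abs, abs_div,
      abs_of_pos h0]
  have hb := Complex.exp_bound (x := ((r / s n : ℝ) : ℂ) * Complex.I) (n := 3)
    (by rw [hz]; exact (div_le_one h0).2 ((le_max_left _ _).trans hn)) (by norm_num)
  rw [hz] at hb
  have hc : (s n : ℂ) ≠ 0 := by exact_mod_cast h0.ne'
  have he : ((s n ^ 2 : ℝ) : ℂ) * expRemainder (r / s n) - ((-(r ^ 2 / 2) : ℝ) : ℂ) =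
      ((s n ^ 2 : ℝ) : ℂ) * (Complex.exp (((r / s n : ℝ) : ℂ) * Complex.I) -
        ∑ m ∈ Finset.range 3, (((r / s n : ℝ) : ℂ) * Complex.I) ^ m / (m.factorial : ℂ)) := by
    simp only [expRemainder, Finset.sum_range_succ, Finset.sum_range_zero, mul_pow, Complex.I_sq]
    push_cast
    field_simp
    simp [Nat.factorial]
    ring
  rw [he, norm_mul, Complex.norm_real, Real.norm_eq_abs, abs_of_pos (by positivity)]
  calc s n ^ 2 * _ ≤ s n ^ 2 * ((|r| / s n) ^ 3 * 1) := by
        gcongr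
        refine hb.trans ?_
        gcongr
        norm_num [Nat.factorial]
    _ = |r| ^ 3 / s n := by field_simp

/-! ### Integrals against the design density. -/

lemma integrable_withDensity_ofReal_of_le {E : Type*} [NormedAddCommGroup E] {α : Type*}
    {mα : MeasurableSpace α} {μ : Measure α} {f : α → ℝ} {C : ℝ} (hC : ∀ y, f y ≤ C) {g : α → E}
    (hg : Integrable g μ) : Integrable g (μ.withDensity fun y => ENNReal.ofReal (f y)) := by
  refine (hg.smul_measure (ENNReal.ofReal_ne_top (r := C))).mono_measure ?_
  rw [← withDensity_const]
  exact withDensity_mono (.of_forall fun y => ENNReal.ofReal_le_ofReal (hC y))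

lemma integral_withDensity_ofReal {α : Type*} {mα : MeasurableSpace α} {μ : Measure α}
    {f : α → ℝ} (hf : Measurable f) (hf0 : ∀ y, 0 ≤ f y) (g : α → ℂ) :
    ∫ y, g y ∂(μ.withDensity fun y => ENNReal.ofReal (f y)) = ∫ y, f y • g y ∂μ := by
  rw [integral_withDensity_eq_integral_toReal_smul hf.ennreal_ofReal
    (.of_forall fun _ => ENNReal.ofReal_lt_top)]
  simp [ENNReal.toReal_ofReal (hf0 _)]

lemma integral_comp_sub_div (φ : ℝ → ℂ) (x : ℝ) {h : ℝ} (hh : 0 < h) :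
    ∫ y, φ ((y - x) / h) = h • ∫ u, φ u := by
  rw [integral_sub_right_eq_self (fun y => φ (y / h)) x, Measure.integral_comp_div,
    abs_of_pos hh]

lemma integrable_score_mul_kernel {ν : Measure ℝ} {ψ w f : ℝ → ℝ} {x C : ℝ}
    (hψ : Integrable ψ ν) (hfC : ∀ y, f y ≤ C) (hw : Integrable w) {h : ℝ} (hh : 0 < h) (s : ℝ) :
    Integrable (fun z : ℝ × ℝ => ψ z.1 * w ((z.2 - x) / h) / s)
      (ν.prod (volume.withDensity fun y => ENNReal.ofReal (f y))) := by
  have hk : Integrable fun y => w ((y - x) / h) := (hw.comp_div hh.ne').comp_sub_right x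
  exact (hψ.mul_prod (integrable_withDensity_ofReal_of_le hfC hk)).div_const s

/-! ### Expansion of one summand's characteristic function. -/

section Core

variable {ν : Measure ℝ} [IsProbabilityMeasure ν] {ψ w f : ℝ → ℝ} {x C : ℝ}
  [IsProbabilityMeasure (volume.withDensity fun y => ENNReal.ofReal (f y))]

/-- The linear term integrates to zero: its integral factors over the product measure, and one
factor is `∫ ψ = 0`. -/
lemma integral_exp_score_mul_kernel_sub_one (hψ : Integrable ψ ν) (hψ0 : ∫ e, ψ e ∂ν = 0)
    (hfC : ∀ y, f y ≤ C) (hw : Integrable w) {h : ℝ} (hh : 0 < h) (s : ℝ) :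
    Integrable (fun z : ℝ × ℝ => expRemainder (ψ z.1 * w ((z.2 - x) / h) / s))
      (ν.prod (volume.withDensity fun y => ENNReal.ofReal (f y))) ∧
    (∫ z : ℝ × ℝ, Complex.exp ((ψ z.1 * w ((z.2 - x) / h) / s : ℝ) * Complex.I)
      ∂ν.prod (volume.withDensity fun y => ENNReal.ofReal (f y))) - 1 =
    ∫ z : ℝ × ℝ, expRemainder (ψ z.1 * w ((z.2 - x) / h) / s)
      ∂ν.prod (volume.withDensity fun y => ENNReal.ofReal (f y)) := by
  set ρ := ν.prod (volume.withDensity fun y => ENNReal.ofReal (f y))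
  have hξ := integrable_score_mul_kernel (x := x) hψ hfC hw hh s
  have hξI : Integrable (fun z : ℝ × ℝ =>
      ((ψ z.1 * w ((z.2 - x) / h) / s : ℝ) : ℂ) * Complex.I) ρ := hξ.ofReal.mul_const _
  have hexp : Integrable (fun z : ℝ × ℝ =>
      Complex.exp ((ψ z.1 * w ((z.2 - x) / h) / s : ℝ) * Complex.I)) ρ := by
    refine (integrable_const (1 : ℝ)).mono
      (Complex.continuous_exp.comp_aestronglyMeasurable hξI.aestronglyMeasurable) ?_
    exact .of_forall fun z => by rw [Complex.norm_exp_ofReal_mul_I]; simp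
  have hmean : ∫ z : ℝ × ℝ, ψ z.1 * w ((z.2 - x) / h) / s ∂ρ = 0 := by
    rw [integral_div, integral_prod_mul ψ (fun y => w ((y - x) / h)), hψ0]
    simp
  have h1 : Integrable (fun z : ℝ × ℝ =>
      Complex.exp ((ψ z.1 * w ((z.2 - x) / h) / s : ℝ) * Complex.I) - 1) ρ :=
    hexp.sub (integrable_const 1)
  refine ⟨h1.sub hξI, ?_⟩
  unfold expRemainder
  rw [integral_sub h1 hξI, integral_sub hexp (integrable_const 1), integral_mul_const,
    integral_complex_ofReal, hmean]
  simp

lemma integral_prod_expRemainder_rescale (hψ : Integrable ψ ν) (hψ0 : ∫ e, ψ e ∂ν = 0)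
    (hf : Measurable f) (hf0 : ∀ y, 0 ≤ f y) (hfC : ∀ y, f y ≤ C) (hw : Integrable w)
    {h : ℝ} (hh : 0 < h) (s : ℝ)
    (hint : Integrable (fun z : ℝ × ℝ => f (x + h * z.2) • expRemainder (ψ z.1 * w z.2 / s))
      (ν.prod volume)) :
    ∫ z : ℝ × ℝ, expRemainder (ψ z.1 * w ((z.2 - x) / h) / s)
      ∂ν.prod (volume.withDensity fun y => ENNReal.ofReal (f y)) =
    h • ∫ z : ℝ × ℝ, f (x + h * z.2) • expRemainder (ψ z.1 * w z.2 / s) ∂ν.prod volume := by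
  rw [integral_prod _ (integral_exp_score_mul_kernel_sub_one hψ hψ0 hfC hw hh s).1,
    integral_prod _ hint, ← integral_smul]
  refine integral_congr_ae (.of_forall fun e => ?_)
  dsimp only
  rw [integral_withDensity_ofReal hf hf0, ← integral_comp_sub_div _ x hh]
  refine integral_congr_ae (.of_forall fun y => ?_)
  dsimp only
  rw [mul_div_cancel₀ _ hh.ne', add_sub_cancel]

/-- The second-order expansion of the characteristic function of one summand. -/
lemma tendsto_nat_mul_integral_exp_sub_one (hψm : Measurable ψ)
    (hψ2 : Integrable (fun e => ψ e ^ 2) ν) (hψ0 : ∫ e, ψ e ∂ν = 0)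
    (hf : Measurable f) (hf0 : ∀ y, 0 ≤ f y) (hfC : ∀ y, f y ≤ C) (hfx : ContinuousAt f x)
    (hwm : Measurable w) (hw : Integrable w) (hw2 : Integrable fun u => w u ^ 2)
    {h : ℕ → ℝ} (hh_zero : Tendsto h atTop (𝓝 0))
    (hh_top : Tendsto (fun n : ℕ => (n : ℝ) * h n) atTop atTop) :
    Tendsto (fun n : ℕ => (n : ℂ) *
      ((∫ z : ℝ × ℝ, Complex.exp ((ψ z.1 * w ((z.2 - x) / h n) / √(n * h n) : ℝ) * Complex.I)
        ∂ν.prod (volume.withDensity fun y => ENNReal.ofReal (f y))) - 1)) atTop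
      (𝓝 ((-(f x * (∫ e, ψ e ^ 2 ∂ν) * (∫ u, w u ^ 2) / 2) : ℝ) : ℂ)) := by
  have hψ : Integrable ψ ν :=
    ((memLp_two_iff_integrable_sq hψm.aestronglyMeasurable).2 hψ2).integrable (by norm_num)
  have hsq : Integrable (fun z : ℝ × ℝ => ψ z.1 ^ 2 * w z.2 ^ 2) (ν.prod volume) :=
    hψ2.mul_prod hw2
  have hpos : ∀ᶠ n : ℕ in atTop, 0 < (n : ℝ) * h n := hh_top.eventually_gt_atTop 0
  have hs : Tendsto (fun n : ℕ => √(n * h n)) atTop atTop := Real.tendsto_sqrt_atTop.comp hh_top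
  have hmeas (n : ℕ) : Measurable fun z : ℝ × ℝ =>
      f (x + h n * z.2) • expRemainder (ψ z.1 * w z.2 / √(n * h n)) :=
    (hf.comp (by fun_prop)).smul (continuous_expRemainder.measurable.comp (by fun_prop))
  have hbound {n : ℕ} (hn : 0 < (n : ℝ) * h n) (z : ℝ × ℝ) :
      ‖((n * h n : ℝ) : ℂ) * (f (x + h n * z.2) • expRemainder (ψ z.1 * w z.2 / √(n * h n)))‖ ≤
        C * (3 * (ψ z.1 ^ 2 * w z.2 ^ 2)) := by
    rw [norm_mul, norm_smul, Complex.norm_real, Real.norm_of_nonneg hn.le,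
      Real.norm_of_nonneg (hf0 _)]
    have h1 := norm_expRemainder_le (ψ z.1 * w z.2 / √(n * h n))
    rw [div_pow, Real.sq_sqrt hn.le] at h1
    calc _ ≤ n * h n * (C * (3 * ((ψ z.1 * w z.2) ^ 2 / (n * h n)))) := by
          gcongr
          · exact (hf0 x).trans (hfC x)
          · exact hfC _
      _ = _ := by
          have hn1 := left_ne_zero_of_mul hn.ne'
          have hn2 := right_ne_zero_of_mul hn.ne'
          field_simp
  have hint {n : ℕ} (hn : 0 < (n : ℝ) * h n) :
      Integrable (fun z : ℝ × ℝ =>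
        f (x + h n * z.2) • expRemainder (ψ z.1 * w z.2 / √(n * h n))) (ν.prod volume) := by
    -- The bound controls the integrand times `n * h n`; this nonzero constant is then divided out.
    have hne : ((n * h n : ℝ) : ℂ) ≠ 0 := by exact_mod_cast hn.ne'
    refine (integrable_const_mul_iff (isUnit_iff_ne_zero.2 hne) _).1 ?_
    exact ((hsq.const_mul 3).const_mul C).mono' ((hmeas n).const_mul _).aestronglyMeasurable
      (.of_forall fun z => hbound hn z)
  have hlim : Tendsto (fun n : ℕ => ∫ z : ℝ × ℝ, ((n * h n : ℝ) : ℂ) *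
      (f (x + h n * z.2) • expRemainder (ψ z.1 * w z.2 / √(n * h n))) ∂ν.prod volume) atTop
      (𝓝 (∫ z : ℝ × ℝ, ((-(f x / 2) * (ψ z.1 ^ 2 * w z.2 ^ 2) : ℝ) : ℂ) ∂ν.prod volume)) := by
    refine tendsto_integral_filter_of_dominated_convergence
      (fun z => C * (3 * (ψ z.1 ^ 2 * w z.2 ^ 2)))
      (.of_forall fun n => ((hmeas n).const_mul _).aestronglyMeasurable)
      (hpos.mono fun n hn => .of_forall fun z => hbound hn z)
      ((hsq.const_mul 3).const_mul C) (.of_forall fun z => ?_)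
    have hf' : Tendsto (fun n => ((f (x + h n * z.2) : ℝ) : ℂ)) atTop (𝓝 (f x)) := by
      refine (Complex.continuous_ofReal.tendsto _).comp (hfx.tendsto.comp ?_)
      simpa using (hh_zero.mul_const z.2).const_add x
    have := hf'.mul (tendsto_sq_mul_expRemainder_div hs (ψ z.1 * w z.2))
    refine (this.congr' ?_).trans (le_of_eq ?_)
    · filter_upwards [hpos] with n hn
      rw [Real.sq_sqrt hn.le, Complex.real_smul]
      ring
    · push_cast
      ring_nf
  have hval : ∫ z : ℝ × ℝ, ((-(f x / 2) * (ψ z.1 ^ 2 * w z.2 ^ 2) : ℝ) : ℂ) ∂ν.prod volume =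
      ((-(f x * (∫ e, ψ e ^ 2 ∂ν) * (∫ u, w u ^ 2) / 2) : ℝ) : ℂ) := by
    rw [integral_complex_ofReal, integral_const_mul,
      integral_prod_mul (fun e => ψ e ^ 2) (fun u => w u ^ 2)]
    push_cast
    ring
  rw [hval] at hlim
  refine hlim.congr' ?_
  filter_upwards [hpos] with n hn
  have hhn : 0 < h n := pos_of_mul_pos_right hn n.cast_nonneg
  rw [(integral_exp_score_mul_kernel_sub_one hψ hψ0 hfC hw hhn _).2,
    integral_prod_expRemainder_rescale hψ hψ0 hf hf0 hfC hw hhn _ (hint hn),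
    integral_const_mul, Complex.real_smul]
  push_cast
  ring

end Core

/-! ### Regularity of the density and moments of the score. -/

lemma bounded_of_bounded_deriv_Ioo {f : ℝ → ℝ} {a b x M : ℝ} (hx : x ∈ Set.Ioo a b)
    (hsupp : ∀ y, y ∉ Set.Ioo a b → f y = 0) (hdiff : DifferentiableOn ℝ f (Set.Ioo a b))
    (hM : ∀ y ∈ Set.Ioo a b, |deriv f y| ≤ M) : ∃ C, ∀ y, f y ≤ C := by
  have hM0 : 0 ≤ M := (abs_nonneg _).trans (hM x hx)
  refine ⟨|f x| + M * (b - a), fun y => ?_⟩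
  by_cases hy : y ∈ Set.Ioo a b
  · have h1 := (convex_Ioo a b).norm_image_sub_le_of_norm_deriv_le
      (fun z hz => (hdiff z hz).differentiableAt (isOpen_Ioo.mem_nhds hz)) hM hx hy
    have h2 : |y - x| ≤ b - a := abs_le.2 ⟨by linarith [hx.2, hy.1], by linarith [hx.1, hy.2]⟩
    rw [Real.norm_eq_abs, Real.norm_eq_abs] at h1
    have h3 := mul_le_mul_of_nonneg_left h2 hM0
    linarith [le_abs_self (f y - f x), le_abs_self (f x)]
  · rw [hsupp y hy]
    have : 0 ≤ b - a := by linarith [hx.1, hx.2]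
    positivity

lemma measurable_of_continuousOn_of_eq_zero {f : ℝ → ℝ} {s : Set ℝ} (hs : MeasurableSet s)
    (hsupp : ∀ y, y ∉ s → f y = 0) (hf : ContinuousOn f s) : Measurable f := by
  classical
  have : f = s.piecewise f 0 := by
    ext y
    by_cases hy : y ∈ s <;> simp [hy, hsupp]
  rw [this]
  exact hf.measurable_piecewise continuousOn_const hs

lemma measurable_lpScore (p : ℝ) : Measurable (lpScore p) := by
  have h : Measurable Real.sign := by
    unfold Real.sign
    exact .ite measurableSet_Iio measurable_const (.ite measurableSet_Ioi measurable_const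
      measurable_const)
  exact (measurable_norm.pow_const (p - 1)).mul h

/-- The hypothesis excludes `p = 1`, `e = 0`, where `Real.sign 0 = 0` but `0 ^ 0 = 1`. -/
lemma lpScore_sq {p e : ℝ} (h : p ≤ 1 → e ≠ 0) : lpScore p e ^ 2 = |e| ^ (2 * p - 2) := by
  rcases eq_or_ne e 0 with rfl | he
  · have hp : 1 < p := not_le.1 fun hp => h hp rfl
    simp [lpScore, Real.zero_rpow (by linarith : 2 * p - 2 ≠ 0)]
  · have hs : Real.sign e ^ 2 = 1 := by
      rcases Real.sign_apply_eq_of_ne_zero e he with h | h <;> simp [h]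
    rw [lpScore, mul_pow, hs, mul_one, ← Real.rpow_natCast, ← Real.rpow_mul (abs_nonneg e)]
    congr 1
    push_cast
    ring

/-- With `y = |e| ^ (p - 1)` this is `y ^ 2 ≤ 1 + y ^ (2 + δ)`; it makes the score square
integrable. -/
lemma abs_rpow_le_one_add {p δ : ℝ} (hδ : 0 < δ) (e : ℝ) :
    |e| ^ (2 * p - 2) ≤ 1 + |e| ^ ((p - 1) * (2 + δ)) := by
  have h0 : 0 ≤ |e| ^ (p - 1) := by positivity
  rw [show 2 * p - 2 = (p - 1) * 2 by ring, Real.rpow_mul (abs_nonneg e),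
    Real.rpow_mul (abs_nonneg e)]
  rcases le_total (|e| ^ (p - 1)) 1 with h | h
  · have := Real.rpow_le_one h0 h (by norm_num : (0 : ℝ) ≤ 2)
    have : 0 ≤ (|e| ^ (p - 1)) ^ (2 + δ) := by positivity
    linarith
  · have := Real.rpow_le_rpow_of_exponent_le h (by linarith : (2 : ℝ) ≤ 2 + δ)
    linarith

/-! ### Kernel moments. -/

section Kernel

variable {K : ℝ → ℝ}

lemma integrable_kernel_mul_of_supported (hK_meas : Measurable K)
    (hK_supp : ∀ u, u ∉ Set.Icc (-1 : ℝ) 1 → K u = 0) (hK_sq : Integrable fun u => K u ^ 2)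
    {q : ℝ → ℝ} (hq : Continuous q) : Integrable fun u => q u * K u ^ 2 := by
  obtain ⟨B, hB⟩ := isCompact_Icc.exists_bound_of_continuousOn
    (hq.continuousOn (s := Set.Icc (-1 : ℝ) 1))
  refine (hK_sq.const_mul B).mono' (hq.measurable.mul (hK_meas.pow_const 2)).aestronglyMeasurable
    (.of_forall fun u => ?_)
  by_cases hu : u ∈ Set.Icc (-1 : ℝ) 1
  · rw [norm_mul, Real.norm_of_nonneg (sq_nonneg (K u))]
    exact mul_le_mul_of_nonneg_right (hB u hu) (sq_nonneg _)
  · simp [hK_supp u hu]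

/-- Dominate `|w|` by `1 + w ^ 2` on the support. -/
lemma integrable_of_sq_of_supported {w : ℝ → ℝ} (hw : Measurable w)
    (hsupp : ∀ u, u ∉ Set.Icc (-1 : ℝ) 1 → w u = 0) (hsq : Integrable fun u => w u ^ 2) :
    Integrable w := by
  have h1 : Integrable ((Set.Icc (-1 : ℝ) 1).indicator fun _ => (1 : ℝ)) :=
    (integrable_indicator_iff measurableSet_Icc).2 (integrableOn_const (by simp))
  refine (h1.add hsq).mono' hw.aestronglyMeasurable (.of_forall fun u => ?_)
  by_cases hu : u ∈ Set.Icc (-1 : ℝ) 1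
  · simp only [Pi.add_apply, Set.indicator_of_mem hu, Real.norm_eq_abs]
    nlinarith [sq_abs (w u), sq_nonneg (|w u| - 1)]
  · simp [hsupp u hu, Set.indicator_of_notMem hu]

lemma integral_mul_kernel_sq_eq_zero (hK_symm : ∀ u, K (-u) = K u) : ∫ u, u * K u ^ 2 = 0 := by
  have h := integral_neg_eq_self (fun u : ℝ => u * K u ^ 2) volume
  simp only [hK_symm, neg_mul, integral_neg] at h
  linarith

lemma integral_affine_mul_kernel_sq (hK_meas : Measurable K) (hK_symm : ∀ u, K (-u) = K u)
    (hK_supp : ∀ u, u ∉ Set.Icc (-1 : ℝ) 1 → K u = 0) (hK_sq : Integrable fun u => K u ^ 2)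
    (c d : ℝ) : ∫ u, ((c + d * u) * K u) ^ 2 =
      c ^ 2 * roughness K + d ^ 2 * secondMoment fun u => K u ^ 2 := by
  have h1 := integrable_kernel_mul_of_supported hK_meas hK_supp hK_sq continuous_id
  have h2 := integrable_kernel_mul_of_supported hK_meas hK_supp hK_sq (continuous_pow 2)
  have he (u : ℝ) : ((c + d * u) * K u) ^ 2 =
      c ^ 2 * K u ^ 2 + 2 * c * d * (id u * K u ^ 2) + d ^ 2 * (u ^ 2 * K u ^ 2) := by
    simp only [id]; ring
  simp_rw [he]
  have h01 : Integrable fun u => c ^ 2 * K u ^ 2 + 2 * c * d * (id u * K u ^ 2) :=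
    (hK_sq.const_mul _).add (h1.const_mul _)
  rw [integral_add h01 (h2.const_mul _), integral_add (hK_sq.const_mul _) (h1.const_mul _), integral_const_mul, integral_const_mul,
    integral_const_mul]
  simp only [id]
  rw [integral_mul_kernel_sq_eq_zero hK_symm]
  simp [roughness, secondMoment]

end Kernel

/-! ### Reduction to i.i.d. sums and conclusion. -/

lemma kernelSum_linear_combination {Ω : Type*} (p : ℝ) (K : ℝ → ℝ) (X ε : ℕ → Ω → ℝ) (x : ℝ)
    {h : ℝ} {n : ℕ} (hh : 0 < h) (hn : 0 < (n : ℝ)) (c d : ℝ) (ω : Ω) :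
    c * kernelSum p K X ε x h 0 n ω + d * kernelSum p K X ε x h 1 n ω =
      ∑ i ∈ Finset.range n, lpScore p (ε i ω) *
        ((c + d * ((X i ω - x) / h)) * K ((X i ω - x) / h)) / √(n * h) := by
  simp only [kernelSum, Finset.mul_sum, ← Finset.sum_add_distrib, scaledKernel]
  refine Finset.sum_congr rfl fun i _ => ?_
  have hs : √(h / n) = h / √(n * h) := by
    rw [eq_div_iff (by positivity), ← Real.sqrt_mul (by positivity),
      show h / n * (n * h) = h ^ 2 by field_simp, Real.sqrt_sq hh.le]
  rw [hs]
  have : √(n * h) ≠ 0 := by positivity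
  field_simp

lemma posSemidef_smul_diag {c r s : ℝ} (hc : 0 ≤ c) (hr : 0 ≤ r) (hs : 0 ≤ s) :
    (c • !![r, 0; 0, s]).PosSemidef := by
  have : c • !![r, 0; 0, s] = Matrix.diagonal ![c * r, c * s] := by
    ext i j; fin_cases i <;> fin_cases j <;> simp
  rw [this]
  refine Matrix.PosSemidef.diagonal fun i => ?_
  fin_cases i
  · exact mul_nonneg hc hr
  · exact mul_nonneg hc hs

lemma charFun_map_eq_pow_of_inner_eq_sum {Ω E β : Type*} {mΩ : MeasurableSpace Ω}
    {mβ : MeasurableSpace β} {P : Measure Ω} [NormedAddCommGroup E] [InnerProductSpace ℝ E]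
    [MeasurableSpace E] [BorelSpace E] {V : Ω → E} {Z : ℕ → Ω → β}
    {g : β → ℝ} {n : ℕ} {t : E} (hV : AEMeasurable V P) (hg : Measurable g)
    (hZ_indep : iIndepFun Z P) (hZ_ident : ∀ i, IdentDistrib (Z i) (Z 0) P P)
    (hsum : ∀ ω, inner ℝ (V ω) t = ∑ i ∈ Finset.range n, g (Z i ω)) :
    charFun (P.map V) t = (∫ z, Complex.exp (g z * Complex.I) ∂P.map (Z 0)) ^ n := by
  have mgZ (i : ℕ) : AEMeasurable (fun ω => g (Z i ω)) P :=
    hg.comp_aemeasurable (hZ_ident i).aemeasurable_fst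
  have h1 := ((hZ_indep.comp (fun _ => g) fun _ => hg).restrict
    (Finset.range n)).charFun_map_fun_finsetSum_eq_prod (fun i _ => mgZ i)
  have h2 (i : ℕ) : P.map (fun ω => g (Z i ω)) = P.map (fun ω => g (Z 0 ω)) :=
    ((hZ_ident i).comp hg).map_eq
  -- Frequency `1` suffices, since `t` is already absorbed into `g`.
  have h3 := congrFun h1 1
  simp only [h2, Finset.prod_const, Finset.card_range, Pi.pow_apply] at h3
  have hcont : Continuous fun v : E => Complex.exp ((inner ℝ v t : ℝ) * Complex.I) := by fun_prop
  rw [charFun_apply, integral_map hV hcont.measurable.aestronglyMeasurable]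
  simp_rw [hsum]
  rw [integral_map (hZ_ident 0).aemeasurable_snd (by fun_prop)]
  rw [charFun_apply_real, charFun_apply_real,
    integral_map (Finset.aemeasurable_fun_sum _ fun i _ => mgZ i) (by fun_prop),
    integral_map (mgZ 0) (by fun_prop)] at h3
  simpa using h3

theorem lemma1 {Ω : Type*} [MeasurableSpace Ω] (P : Measure Ω) [IsProbabilityMeasure P]
    (p δ a b x : ℝ) (X ε : ℕ → Ω → ℝ) (f K : ℝ → ℝ) (h : ℕ → ℝ)
    -- the errors: i.i.d., centred score, moment of order `(p - 1)(2 + δ)`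
    (hε_indep : iIndepFun ε P)
    (hε_ident : ∀ i, IdentDistrib (ε i) (ε 0) P P)
    (hε_mean : ∫ ω, lpScore p (ε 0 ω) ∂P = 0)
    (hδ : 0 < δ)
    (hε_moment : Integrable (fun ω => |ε 0 ω| ^ ((p - 1) * (2 + δ))) P)
    -- for `p ≤ 1` the error has no atom at `0`, where `|ε|^(p-1)` is singular or undefined
    (hε_zero : p ≤ 1 → ∀ᵐ ω ∂P, ε 0 ω ≠ 0)
    -- the design points: independent with density `f`, independent of the errors
    (hX_indep : iIndepFun X P)
    (hX_law : ∀ i, HasLaw (X i) (volume.withDensity (fun y => ENNReal.ofReal (f y))) P)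
    (hXε : IndepFun (fun ω i => X i ω) (fun ω i => ε i ω) P)
    (hf_nonneg : ∀ y, 0 ≤ f y)
    (hf_supp : ∀ y, y ∉ Set.Ioo a b → f y = 0)
    (hf_diff : DifferentiableOn ℝ f (Set.Ioo a b))
    (hf_deriv : ∃ M : ℝ, ∀ y ∈ Set.Ioo a b, |deriv f y| ≤ M)
    -- the kernel
    (hK_meas : Measurable K)
    (hK_symm : ∀ u, K (-u) = K u)
    (hK_nonneg : ∀ u, 0 ≤ K u)
    (hK_supp : ∀ u, u ∉ Set.Icc (-1 : ℝ) 1 → K u = 0)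
    (hK_sq : Integrable (fun u => K u ^ 2))
    -- the bandwidth
    (hh_zero : Tendsto h atTop (𝓝 0))
    (hh_top : Tendsto (fun n : ℕ => (n : ℝ) * h n) atTop atTop)
    (hh_five : Tendsto (fun n : ℕ => (n : ℝ) * h n ^ 5) atTop (𝓝 0))
    -- the interior point
    (hx : x ∈ Set.Ioo a b) :
    TendstoInDistribution
      (fun (n : ℕ) (ω : Ω) =>
        (!₂[kernelSum p K X ε x (h n) 0 n ω, kernelSum p K X ε x (h n) 1 n ω] :
          EuclideanSpace ℝ (Fin 2)))
      atTop
      (id : EuclideanSpace ℝ (Fin 2) → EuclideanSpace ℝ (Fin 2))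
      (fun _ => P)
      (multivariateGaussian 0
        ((f x * ∫ ω, |ε 0 ω| ^ (2 * p - 2) ∂P) •
          !![roughness K, 0; 0, secondMoment (fun u => K u ^ 2)])) := by
  have mε (i : ℕ) : AEMeasurable (ε i) P := (hε_ident i).aemeasurable_fst
  have mX (i : ℕ) : AEMeasurable (X i) P := (hX_law i).aemeasurable
  have mψ : Measurable (lpScore p) := measurable_lpScore p
  have mZ : AEMeasurable (fun ω => (ε 0 ω, X 0 ω)) P := (mε 0).prodMk (mX 0)
  have : IsProbabilityMeasure (P.map (ε 0)) := Measure.isProbabilityMeasure_map (mε 0)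
  have hμX := (hX_law 0).map_eq
  have : IsProbabilityMeasure (volume.withDensity fun y => ENNReal.ofReal (f y)) :=
    hμX ▸ Measure.isProbabilityMeasure_map (mX 0)
  have hpair (i : ℕ) : IndepFun (ε i) (X i) P :=
    (hXε.comp (measurable_pi_apply i) (measurable_pi_apply i)).symm
  have hZ_indep : iIndepFun (fun i ω => (ε i ω, X i ω)) P :=
    iIndepFun_prodMk_of_aemeasurable mε mX hε_indep hX_indep hXε.symm
  have hZ_ident (i : ℕ) :
      IdentDistrib (fun ω => (ε i ω, X i ω)) (fun ω => (ε 0 ω, X 0 ω)) P P :=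
    (hε_ident i).prodMk
      ⟨mX i, mX 0, (hX_law i).map_eq.trans (hX_law 0).map_eq.symm⟩ (hpair i) (hpair 0)
  have hZ_law : P.map (fun ω => (ε 0 ω, X 0 ω)) =
      (P.map (ε 0)).prod (volume.withDensity fun y => ENNReal.ofReal (f y)) := by
    rw [(hpair 0).map_prod_eq_prod_map_map (mε 0) (mX 0), hμX]
  -- the score is centred and square integrable
  have hsq : (fun ω => lpScore p (ε 0 ω) ^ 2) =ᵐ[P] fun ω => |ε 0 ω| ^ (2 * p - 2) := by
    by_cases hp : p ≤ 1
    · filter_upwards [hε_zero hp] with ω hω using lpScore_sq fun _ => hω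
    · exact .of_forall fun ω => lpScore_sq fun h => absurd h hp
  have hmom : Integrable (fun ω => |ε 0 ω| ^ (2 * p - 2)) P := by
    refine ((integrable_const (1 : ℝ)).add hε_moment).mono'
      (((measurable_norm.pow_const (2 * p - 2)).comp_aemeasurable (mε 0)).aestronglyMeasurable)
      (.of_forall fun ω => ?_)
    rw [Real.norm_of_nonneg (by positivity)]
    exact abs_rpow_le_one_add hδ _
  have hψ2 : Integrable (fun e => lpScore p e ^ 2) (P.map (ε 0)) :=
    (integrable_map_measure (mψ.pow_const 2).aestronglyMeasurable (mε 0)).2 (hmom.congr hsq.symm)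
  have hψ2_eq : ∫ e, lpScore p e ^ 2 ∂P.map (ε 0) = ∫ ω, |ε 0 ω| ^ (2 * p - 2) ∂P := by
    rw [integral_map (mε 0) (mψ.pow_const 2).aestronglyMeasurable, integral_congr_ae hsq]
  have hψ0 : ∫ e, lpScore p e ∂P.map (ε 0) = 0 := by
    rw [integral_map (mε 0) mψ.aestronglyMeasurable, hε_mean]
  -- the density is measurable, bounded and continuous at `x`
  obtain ⟨M, hM⟩ := hf_deriv
  obtain ⟨C, hfC⟩ := bounded_of_bounded_deriv_Ioo hx hf_supp hf_diff hM
  have mf : Measurable f :=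
    measurable_of_continuousOn_of_eq_zero measurableSet_Ioo hf_supp hf_diff.continuousOn
  have hfx : ContinuousAt f x := hf_diff.continuousOn.continuousAt (isOpen_Ioo.mem_nhds hx)
  have hS : ((f x * ∫ ω, |ε 0 ω| ^ (2 * p - 2) ∂P) •
      !![roughness K, 0; 0, secondMoment (fun u => K u ^ 2)]).PosSemidef :=
    posSemidef_smul_diag
      (mul_nonneg (hf_nonneg x) (integral_nonneg fun ω => Real.rpow_nonneg (abs_nonneg _) _))
      (integral_nonneg fun u => sq_nonneg _)
      (integral_nonneg fun u => mul_nonneg (sq_nonneg _) (sq_nonneg _))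
  have mV (j n : ℕ) : AEMeasurable (kernelSum p K X ε x (h n) j n) P := by
    refine (Finset.aemeasurable_fun_sum _ fun i _ => ?_).const_mul _
    exact ((((mX i).sub_const x).pow_const j).mul (mψ.comp_aemeasurable (mε i))).mul
      ((hK_meas.comp_aemeasurable (((mX i).sub_const x).div_const (h n))).div_const (h n))
  have mVec (n : ℕ) : AEMeasurable (fun ω =>
      (!₂[kernelSum p K X ε x (h n) 0 n ω, kernelSum p K X ε x (h n) 1 n ω] :
        EuclideanSpace ℝ (Fin 2))) P := by
    refine (WithLp.measurable_toLp 2 _).comp_aemeasurable (aemeasurable_pi_lambda _ fun j => ?_)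
    fin_cases j
    · exact mV 0 n
    · exact mV 1 n
  refine ⟨mVec, aemeasurable_id, ?_⟩
  refine ProbabilityMeasure.tendsto_iff_tendsto_charFun.2 fun t => ?_
  simp only [ProbabilityMeasure.coe_mk, Measure.map_id]
  rw [charFun_multivariateGaussian hS]
  set w : ℝ → ℝ := fun u => (t 0 + t 1 * u) * K u with hw_def
  have mw : Measurable w := by fun_prop
  have hw2 : Integrable fun u => w u ^ 2 := by
    simp only [hw_def, mul_pow]
    exact integrable_kernel_mul_of_supported hK_meas hK_supp hK_sq (by fun_prop)
  have hw : Integrable w :=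
    integrable_of_sq_of_supported mw (fun u hu => by simp [hw_def, hK_supp u hu]) hw2
  -- If `n aₙ → c` then `(1 + aₙ) ^ n → exp c`, here with `aₙ = φₙ - 1`.
  have hlim := Complex.tendsto_one_add_pow_exp_of_tendsto
    (tendsto_nat_mul_integral_exp_sub_one mψ hψ2 hψ0 mf hf_nonneg hfC hfx mw hw hw2
      hh_zero hh_top)
  rw [integral_affine_mul_kernel_sq hK_meas hK_symm hK_supp hK_sq, hψ2_eq] at hlim
  have hexp : ((-(f x * (∫ ω, |ε 0 ω| ^ (2 * p - 2) ∂P) *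
      (t 0 ^ 2 * roughness K + t 1 ^ 2 * secondMoment fun u => K u ^ 2) / 2) : ℝ) : ℂ) =
      (inner ℝ t (0 : EuclideanSpace ℝ (Fin 2)) : ℝ) * Complex.I -
        (t.ofLp ⬝ᵥ ((f x * ∫ ω, |ε 0 ω| ^ (2 * p - 2) ∂P) •
          !![roughness K, 0; 0, secondMoment (fun u => K u ^ 2)]).mulVec t.ofLp : ℝ) / 2 := by
    rw [inner_zero_right]
    simp [Matrix.mulVec, dotProduct, Fin.sum_univ_two]
    ring
  rw [hexp] at hlim
  refine hlim.congr' ?_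
  filter_upwards [hh_top.eventually_gt_atTop 0] with n hn
  have hn0 : 0 < (n : ℝ) := lt_of_le_of_ne n.cast_nonneg (left_ne_zero_of_mul hn.ne').symm
  have hhn : 0 < h n := pos_of_mul_pos_right hn n.cast_nonneg
  have mg : Measurable fun z : ℝ × ℝ => lpScore p z.1 * w ((z.2 - x) / h n) / √(n * h n) :=
    ((mψ.comp measurable_fst).mul (mw.comp (by fun_prop))).div_const _
  rw [charFun_map_eq_pow_of_inner_eq_sum (mVec n) mg hZ_indep hZ_ident, hZ_law, add_sub_cancel]
  intro ω
  rw [← kernelSum_linear_combination p K X ε x hhn hn0 (t 0) (t 1) ω]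
  simp [PiLp.inner_apply, Fin.sum_univ_two]
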